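/- Let $\mathbb S^2\subset\mathbb R^3$ be the unit sphere with its surface measure $dn$ (of total mass $4\pi$). Let $K:\mathbb S^2\times\mathbb S^2\to\mathbb R$ be continuous, non-negative and invariant under rotations, i.e. $K(n,n')=K(\mathcal Rn,\mathcal Rn')$ for all $n,n'\in\mathbb S^2$ and all $\mathcal R\in SO(3)$, and suppose that $\int_{\mathbb S^2}K(n,n')\,dn=1$ for all $n'\in\mathbb S^2$. Let $H:L^\infty(\mathbb S^2)\to L^\infty(\mathbb S^2)$ be the bounded linear operator on the real space $L^\infty(\mathbb S^2)$ given by $$H[\varphi](n)=\int_{\mathbb S^2}K(n,n')\,\varphi(n')\,dn'.$$ Then: (i) every $\varphi\in L^\infty(\mathbb S^2)$ with $H[\varphi]=\varphi$ is continuous (that is, it agrees almost everywhere with a continuous function); (ii) every $\varphi\in L^\infty(\mathbb S^2)$ with $H[\varphi]=\varphi$ is constant (almost everywhere); (iii) $\operatorname{Ran}(\mathrm{Id}-H)=\left\{\psi\in L^\infty(\mathbb S^2):\ \int_{\mathbb S^2}\psi(n)\,dn=0\right\}$. -/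

import Mathlib

open MeasureTheory
open scoped ENNReal

noncomputable section

namespace Scattering

/-- The unit sphere `S²` of the Euclidean space `ℝ³`. -/
abbrev S2 : Type := Metric.sphere (0 : EuclideanSpace ℝ (Fin 3)) 1

/-- The surface measure of `S²`, of total mass `4π`. (The default `volume` on the subtype is the
restriction of Lebesgue measure, which vanishes, and is not used.) -/
def surf : Measure S2 := (volume : Measure (EuclideanSpace ℝ (Fin 3))).toSphere

instance : IsFiniteMeasure surf := by unfold surf; infer_instance

/-- The real space `L^∞(S²)` with respect to the surface measure. -/
abbrev LInf : Type := Lp ℝ ∞ surf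

lemma norm_rotate (R : Matrix.specialOrthogonalGroup (Fin 3) ℝ) (n : S2) :
    WithLp.toLp 2 ((R : Matrix (Fin 3) (Fin 3) ℝ).mulVec (n : EuclideanSpace ℝ (Fin 3)).ofLp) ∈
      Metric.sphere (0 : EuclideanSpace ℝ (Fin 3)) 1 := by
  have hR : (R : Matrix (Fin 3) (Fin 3) ℝ).transpose * (R : Matrix (Fin 3) (Fin 3) ℝ) = 1 :=
    (Matrix.mem_orthogonalGroup_iff' _ _).1 (Matrix.mem_specialOrthogonalGroup_iff.1 R.2).1
  have hn : ‖(n : EuclideanSpace ℝ (Fin 3))‖ = 1 := by simp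
  have key : ∀ v : Fin 3 → ℝ, ‖(WithLp.toLp 2 v : EuclideanSpace ℝ (Fin 3))‖ ^ 2 =
      dotProduct v v := by
    intro v
    rw [EuclideanSpace.norm_sq_eq]
    simp [dotProduct, sq]
  rw [mem_sphere_zero_iff_norm, ← sq_eq_sq₀ (norm_nonneg _) zero_le_one, key,
    Matrix.dotProduct_mulVec, Matrix.vecMul_mulVec, hR, Matrix.vecMul_one, ← key]
  simp [hn]

/-- The action of a rotation `R ∈ SO(3)` on the sphere, `n ↦ R n`. -/
def rotate (R : Matrix.specialOrthogonalGroup (Fin 3) ℝ) (n : S2) : S2 :=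
  ⟨WithLp.toLp 2 ((R : Matrix (Fin 3) (Fin 3) ℝ).mulVec (n : EuclideanSpace ℝ (Fin 3)).ofLp),
    norm_rotate R n⟩

/-- A scattering kernel: a continuous function `K` on `S² × S²` that is non-negative, invariant
under simultaneous rotations of both arguments, and has `∫ K(n, n') dn = 1` for every `n'`. -/
structure IsScatteringKernel (K : C(S2 × S2, ℝ)) : Prop where
  nonneg : ∀ n n' : S2, 0 ≤ K (n, n')
  rotation_invariant : ∀ (R : Matrix.specialOrthogonalGroup (Fin 3) ℝ) (n n' : S2),
    K (n, n') = K (rotate R n, rotate R n')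
  integral_eq_one : ∀ n' : S2, ∫ n, K (n, n') ∂surf = 1

lemma integrable_coe (φ : LInf) : Integrable φ surf :=
  (Lp.memLp φ).integrable le_top

lemma integrable_kernel_mul (K : C(S2 × S2, ℝ)) (φ : LInf) (n : S2) :
    Integrable (fun n' => K (n, n') * φ n') surf :=
  (integrable_coe φ).bdd_mul (c := ‖K‖)
    (Continuous.aestronglyMeasurable (by fun_prop))
    (Filter.Eventually.of_forall fun n' => K.norm_coe_le_norm (n, n'))

/-- The function `n ↦ ∫ K(n, n') φ(n') dn'`, which is continuous in `n`. -/
def scatterFun (K : C(S2 × S2, ℝ)) (φ : LInf) : C(S2, ℝ) where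
  toFun n := ∫ n', K (n, n') * φ n' ∂surf
  continuous_toFun := by
    refine continuous_of_dominated (bound := fun n' => ‖K‖ * ‖φ n'‖) ?_ ?_ ?_ ?_
    · exact fun n => (integrable_kernel_mul K φ n).aestronglyMeasurable
    · refine fun n => Filter.Eventually.of_forall fun n' => ?_
      rw [norm_mul]
      gcongr
      exact K.norm_coe_le_norm (n, n')
    · exact (integrable_coe φ).norm.const_mul _
    · exact Filter.Eventually.of_forall fun n' => by fun_prop

/-- The scattering operator as a linear map into the continuous functions. -/
def scatterLin (K : C(S2 × S2, ℝ)) : LInf →ₗ[ℝ] C(S2, ℝ) where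
  toFun := scatterFun K
  map_add' φ ψ := by
    ext n
    simp only [scatterFun, ContinuousMap.coe_mk, ContinuousMap.add_apply]
    rw [← integral_add (integrable_kernel_mul K φ n) (integrable_kernel_mul K ψ n)]
    refine integral_congr_ae ?_
    filter_upwards [Lp.coeFn_add φ ψ] with n' h
    rw [h, Pi.add_apply, mul_add]
  map_smul' c φ := by
    ext n
    simp only [scatterFun, ContinuousMap.coe_mk, ContinuousMap.smul_apply, RingHom.id_apply,
      smul_eq_mul]
    rw [← integral_const_mul]
    refine integral_congr_ae ?_
    filter_upwards [Lp.coeFn_smul c φ] with n' h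
    rw [h, Pi.smul_apply, smul_eq_mul]
    ring

lemma norm_scatterLin_le (K : C(S2 × S2, ℝ)) (φ : LInf) :
    ‖scatterLin K φ‖ ≤ ‖K‖ * surf.real Set.univ * ‖φ‖ := by
  refine (ContinuousMap.norm_le _ (by positivity)).2 fun n => ?_
  have h : ∀ᵐ n' ∂surf, ‖K (n, n') * φ n'‖ ≤ ‖K‖ * ‖φ‖ := by
    have h1 : ∀ᵐ n' ∂surf, ‖φ n'‖ ≤ ‖φ‖ := by
      have h2 := ae_le_eLpNormEssSup (f := φ) (μ := surf)
      have h3 : eLpNormEssSup φ surf ≠ ∞ := by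
        simpa [eLpNorm_exponent_top] using (Lp.memLp φ).eLpNorm_ne_top
      filter_upwards [h2] with n' h4
      rw [Lp.norm_def, eLpNorm_exponent_top, ← toReal_enorm]
      exact ENNReal.toReal_mono h3 h4
    filter_upwards [h1] with n' h5
    rw [norm_mul]
    exact mul_le_mul (K.norm_coe_le_norm _) h5 (norm_nonneg _) (norm_nonneg _)
  calc ‖∫ n', K (n, n') * φ n' ∂surf‖ ≤ ‖K‖ * ‖φ‖ * surf.real Set.univ :=
        norm_integral_le_of_norm_le_const h
    _ = ‖K‖ * surf.real Set.univ * ‖φ‖ := by ring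

/-- The scattering operator `H[φ] = ∫ K(·, n') φ(n') dn'`, a bounded linear operator
on `L^∞(S²)`. -/
def scatteringOp (K : C(S2 × S2, ℝ)) : LInf →L[ℝ] LInf :=
  (ContinuousMap.toLp (E := ℝ) ∞ surf ℝ).comp
    ((scatterLin K).mkContinuous (‖K‖ * surf.real Set.univ) (norm_scatterLin_le K))

/-- The defining formula of the scattering operator. -/
lemma scatteringOp_ae (K : C(S2 × S2, ℝ)) (φ : LInf) :
    scatteringOp K φ =ᵐ[surf] fun n => ∫ n', K (n, n') * φ n' ∂surf :=
  ContinuousMap.coeFn_toLp surf (scatterLin K φ)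

end Scattering

end

noncomputable section
namespace Scattering

/-! Any two points of the sphere are swapped by some half-turn, so rotation invariance makes `K`
symmetric and its integral over either variable is 1. A fixed point of `H` has a continuous
representative, since `H` maps into continuous functions; the maximum principle and connectedness of
the sphere make it constant.

`H` preserves integrals, so the range of `Id - H` has mean zero. Conversely, subtract the constant
1/|S²| from `K`: the new operator is compact, agrees with `H` on mean-zero functions and has
mean-zero values. It therefore has no nonzero fixed point, and the Fredholm alternative solves the
equation. -/

instance : surf.IsOpenPosMeasure := by unfold surf; infer_instance

instance : ConnectedSpace S2 :=
  isConnected_iff_connectedSpace.1 <| isConnected_sphere (by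
    rw [← Module.finrank_eq_rank]; simp) 0 zero_le_one

/-! ### Half-turns exchanging two points -/

lemma sum_mul_self_coe (n : S2) : n.1 0 * n.1 0 + n.1 1 * n.1 1 + n.1 2 * n.1 2 = 1 := by
  have h : ‖n.1‖ ^ 2 = 1 := by simp
  rw [EuclideanSpace.norm_sq_eq] at h
  simpa [Fin.sum_univ_three, sq] using h

/-- The half-turn `v ↦ 2 ⟨u, v⟩ u - v` about the axis spanned by a unit vector `u`. -/
lemma halfTurn_mem (u : Fin 3 → ℝ) (hu : u 0 * u 0 + u 1 * u 1 + u 2 * u 2 = 1) :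
    (2 : ℝ) • Matrix.vecMulVec u u - 1 ∈ Matrix.specialOrthogonalGroup (Fin 3) ℝ := by
  rw [Matrix.mem_specialOrthogonalGroup_iff, Matrix.mem_orthogonalGroup_iff]
  have hd : u ⬝ᵥ u = 1 := by simpa [dotProduct, Fin.sum_univ_three] using hu
  constructor
  · have h1 : Matrix.transpose ((2 : ℝ) • Matrix.vecMulVec u u - 1) =
        (2 : ℝ) • Matrix.vecMulVec u u - 1 := by
      simp [Matrix.transpose_vecMulVec]
    have h2 : Matrix.vecMulVec u u * Matrix.vecMulVec u u = Matrix.vecMulVec u u := by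
      rw [Matrix.vecMulVec_mul_vecMulVec, hd]; simp
    rw [h1]
    simp only [sub_mul, mul_sub, smul_mul_assoc, mul_smul_comm, h2, mul_one, one_mul]
    module
  · simp only [Matrix.det_fin_three, Matrix.sub_apply, Matrix.smul_apply, Matrix.vecMulVec_apply,
      smul_eq_mul, Matrix.one_apply]
    simp
    linear_combination 2 * hu

/-- The axis is the bisector `n + m`, normalized; for antipodal points it is any unit vector
orthogonal to `n`. -/
lemma exists_halfTurn_axis (n m : S2) : ∃ u : Fin 3 → ℝ,
    u 0 * u 0 + u 1 * u 1 + u 2 * u 2 = 1 ∧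
      ∀ i, 2 * (u 0 * n.1 0 + u 1 * n.1 1 + u 2 * n.1 2) * u i = n.1 i + m.1 i := by
  have normalize : ∀ s : Fin 3 → ℝ, s ≠ 0 →
      (∀ i, 2 * (s 0 * n.1 0 + s 1 * n.1 1 + s 2 * n.1 2) * s i =
        (s 0 * s 0 + s 1 * s 1 + s 2 * s 2) * (n.1 i + m.1 i)) →
      ∃ u : Fin 3 → ℝ, u 0 * u 0 + u 1 * u 1 + u 2 * u 2 = 1 ∧
        ∀ i, 2 * (u 0 * n.1 0 + u 1 * n.1 1 + u 2 * n.1 2) * u i = n.1 i + m.1 i := by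
    intro s hs h
    have hpos : 0 < s 0 * s 0 + s 1 * s 1 + s 2 * s 2 := by
      have := Matrix.dotProduct_self_star_pos_iff (v := s) |>.2 hs
      simpa [dotProduct, Fin.sum_univ_three] using this
    set q := s 0 * s 0 + s 1 * s 1 + s 2 * s 2
    have hq : (√q)⁻¹ * (√q)⁻¹ * q = 1 := by
      rw [← mul_inv, Real.mul_self_sqrt hpos.le, inv_mul_cancel₀ hpos.ne']
    refine ⟨fun i => (√q)⁻¹ * s i, ?_, fun i => ?_⟩
    · linear_combination hq
    · linear_combination (√q)⁻¹ * (√q)⁻¹ * h i + (n.1 i + m.1 i) * hq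
  have hn := sum_mul_self_coe n
  have hm := sum_mul_self_coe m
  by_cases hs : (fun i => n.1 i + m.1 i) = 0
  · have hs' : ∀ i, n.1 i + m.1 i = 0 := fun i => congrFun hs i
    by_cases hab : n.1 0 = 0 ∧ n.1 1 = 0
    · refine normalize ![1, 0, 0] (fun h => by simpa using congrFun h 0) fun i => ?_
      rw [hs' i]
      simp [hab.1]
    · refine normalize ![- n.1 1, n.1 0, 0] (fun h => hab ⟨?_, ?_⟩) fun i => ?_
      · simpa using congrFun h 1
      · simpa using congrFun h 0
      · rw [hs' i]
        simp only [Matrix.cons_val]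
        ring
  · refine normalize _ hs fun i => ?_
    linear_combination (n.1 i + m.1 i) * (hn - hm)

lemma exists_rotate_swap (n m : S2) :
    ∃ R : Matrix.specialOrthogonalGroup (Fin 3) ℝ, rotate R n = m ∧ rotate R m = n := by
  obtain ⟨u, hu, h⟩ := exists_halfTurn_axis n m
  refine ⟨⟨_, halfTurn_mem u hu⟩, ?_⟩
  have h1 : ∀ v : Fin 3 → ℝ, ∀ i, ((2 : ℝ) • Matrix.vecMulVec u u - 1).mulVec v i =
      2 * (u 0 * v 0 + u 1 * v 1 + u 2 * v 2) * u i - v i := by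
    intro v i
    simp [Matrix.sub_mulVec, Matrix.smul_mulVec, Matrix.vecMulVec_mulVec, dotProduct,
      Fin.sum_univ_three]
    ring
  have h2 : u 0 * n.1 0 + u 1 * n.1 1 + u 2 * n.1 2 = u 0 * m.1 0 + u 1 * m.1 1 + u 2 * m.1 2 := by
    linear_combination u 0 * h 0 + u 1 * h 1 + u 2 * h 2 -
      2 * (u 0 * n.1 0 + u 1 * n.1 1 + u 2 * n.1 2) * hu
  constructor
  · refine Subtype.ext (PiLp.ext fun i => ?_)
    simp only [rotate, h1]
    linear_combination h i
  · refine Subtype.ext (PiLp.ext fun i => ?_)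
    simp only [rotate, h1]
    linear_combination h i - 2 * u i * h2

lemma integrable_of_continuous {f : S2 → ℝ} (hf : Continuous f) : Integrable f surf :=
  hf.integrable_of_hasCompactSupport (HasCompactSupport.of_compactSpace f)

/-! ### Symmetry and the maximum principle -/

namespace IsScatteringKernel

variable {K : C(S2 × S2, ℝ)}

lemma symm (hK : IsScatteringKernel K) (n m : S2) : K (n, m) = K (m, n) := by
  obtain ⟨R, h1, h2⟩ := exists_rotate_swap n m
  rw [hK.rotation_invariant R n m, h1, h2]

lemma integral_right (hK : IsScatteringKernel K) (n : S2) : ∫ n', K (n, n') ∂surf = 1 := by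
  simp_rw [hK.symm n, hK.integral_eq_one n]

lemma exists_pos (hK : IsScatteringKernel K) (n : S2) : ∃ m, 0 < K (n, m) := by
  by_contra! h
  have h0 : ∀ m, K (n, m) = 0 := fun m => le_antisymm (h m) (hK.nonneg n m)
  simpa [h0] using hK.integral_right n

/-- A point where a harmonic function is maximal passes this on to all points it scatters to. -/
lemma eq_of_isMax (hK : IsScatteringKernel K) {f : S2 → ℝ} (hf : Continuous f)
    (hfix : ∀ n, ∫ n', K (n, n') * f n' ∂surf = f n) {n : S2} (hmax : ∀ m, f m ≤ f n)
    {m : S2} (hm : 0 < K (n, m)) : f m = f n := by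
  have hc : Continuous fun n' => K (n, n') * (f n - f n') := by fun_prop
  have hi : ∫ n', K (n, n') * (f n - f n') ∂surf = 0 := by
    simp_rw [mul_sub]
    rw [integral_sub (integrable_of_continuous (by fun_prop))
      (integrable_of_continuous (by fun_prop)), integral_mul_const, hK.integral_right, hfix]
    ring
  have h0 := (integral_eq_zero_iff_of_nonneg
    (fun n' => mul_nonneg (hK.nonneg n n') (sub_nonneg.2 (hmax n')))
    (integrable_of_continuous hc)).1 hi
  -- Vanishing almost everywhere becomes vanishing everywhere, as nonempty open sets have positive
  -- measure.
  have h1 := congrFun ((hc.ae_eq_iff_eq surf continuous_const).1 h0) m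
  have h2 : f n - f m = 0 := (mul_eq_zero.1 h1).resolve_left hm.ne'
  linarith

/-- The maximum principle: a continuous fixed point of the scattering operator is constant. -/
lemma exists_eq_const (hK : IsScatteringKernel K) {f : S2 → ℝ} (hf : Continuous f)
    (hfix : ∀ n, ∫ n', K (n, n') * f n' ∂surf = f n) : ∃ c, ∀ n, f n = c := by
  obtain ⟨n₀, -, hn₀⟩ := isCompact_univ.exists_isMaxOn Set.univ_nonempty hf.continuousOn
  have hmax : ∀ m, f m ≤ f n₀ := fun m => hn₀ (Set.mem_univ m)
  have hclopen : IsClopen {n | f n = f n₀} := by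
    refine ⟨isClosed_eq hf continuous_const, isOpen_iff_mem_nhds.2 fun n (hn : f n = f n₀) => ?_⟩
    -- `K (n, n)` may vanish, so two scatterings are used: from `n` to `m`, then by symmetry from
    -- `m` to a whole neighbourhood of `n`.
    obtain ⟨m, hm⟩ := hK.exists_pos n
    have hfm : f m = f n₀ := (hK.eq_of_isMax hf hfix (by rwa [hn]) hm).trans hn
    have hopen : IsOpen {p | 0 < K (m, p)} := isOpen_lt continuous_const (by fun_prop)
    filter_upwards [hopen.mem_nhds (show 0 < K (m, n) by rwa [hK.symm])] with p hp
    exact (hK.eq_of_isMax hf hfix (by rwa [hfm]) hp).trans hfm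
  have huniv := hclopen.eq_univ ⟨n₀, rfl⟩
  exact ⟨f n₀, Set.eq_univ_iff_forall.1 huniv⟩

end IsScatteringKernel

/-! ### Compactness -/

lemma surf_real_univ_pos : 0 < surf.real Set.univ :=
  ENNReal.toReal_pos (isOpen_univ.measure_ne_zero surf Set.univ_nonempty) (measure_ne_top _ _)

lemma ae_norm_le (φ : LInf) : ∀ᵐ n ∂surf, ‖φ n‖ ≤ ‖φ‖ := by
  have h3 : eLpNormEssSup φ surf ≠ ∞ := by
    simpa [eLpNorm_exponent_top] using (Lp.memLp φ).eLpNorm_ne_top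
  filter_upwards [ae_le_eLpNormEssSup (f := φ) (μ := surf)] with n' h4
  rw [Lp.norm_def, eLpNorm_exponent_top, ← toReal_enorm]
  exact ENNReal.toReal_mono h3 h4

/-- Depends on `φ` only through its norm, hence gives equicontinuity on the unit ball. -/
lemma dist_scatterFun_le (K : C(S2 × S2, ℝ)) (φ : LInf) (n m : S2) :
    dist (scatterFun K φ n) (scatterFun K φ m) ≤
      ‖K.curry n - K.curry m‖ * ‖φ‖ * surf.real Set.univ := by
  rw [dist_eq_norm]
  simp only [scatterFun, ContinuousMap.coe_mk]
  rw [← integral_sub (integrable_kernel_mul K φ n) (integrable_kernel_mul K φ m)]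
  refine norm_integral_le_of_norm_le_const ?_
  filter_upwards [ae_norm_le φ] with n' h
  rw [← sub_mul, norm_mul]
  exact mul_le_mul ((K.curry n - K.curry m).norm_coe_le_norm n') h (norm_nonneg _) (norm_nonneg _)

/-- By the Arzelà-Ascoli theorem, an operator with a continuous kernel is compact. -/
lemma isCompactOperator_scatteringOp (K : C(S2 × S2, ℝ)) : IsCompactOperator (scatteringOp K) := by
  let T := (scatterLin K).mkContinuous (‖K‖ * surf.real Set.univ) (norm_scatterLin_le K)
  let e := ContinuousMap.linearIsometryBoundedOfCompact S2 ℝ ℝ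
  let A := (fun φ => e (T φ)) '' Metric.closedBall (0 : LInf) 1
  have hA : IsCompact (closure A) := by
    refine BoundedContinuousFunction.arzela_ascoli
      (Metric.closedBall (0 : ℝ) (‖K‖ * surf.real Set.univ)) (isCompact_closedBall _ _) A ?_ ?_
    · rintro _ n ⟨φ, hφ, rfl⟩
      rw [mem_closedBall_zero_iff] at hφ ⊢
      calc ‖T φ n‖ ≤ ‖T φ‖ := (T φ).norm_coe_le_norm n
        _ ≤ ‖K‖ * surf.real Set.univ * ‖φ‖ := norm_scatterLin_le K φ
        _ ≤ ‖K‖ * surf.real Set.univ := mul_le_of_le_one_right (by positivity) hφ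
    · intro n
      refine Metric.equicontinuousAt_of_continuity_modulus
        (fun m => ‖K.curry n - K.curry m‖ * surf.real Set.univ) ?_ _ (.of_forall fun m => ?_)
      · have hc : Continuous fun m => ‖K.curry n - K.curry m‖ * surf.real Set.univ := by fun_prop
        simpa using hc.tendsto n
      · rintro ⟨_, φ, hφ, rfl⟩
        rw [mem_closedBall_zero_iff] at hφ
        refine (dist_scatterFun_le K φ n m).trans ?_
        gcongr
        exact mul_le_of_le_one_right (norm_nonneg _) hφ
  have hT : IsCompactOperator T := by
    refine ⟨e.symm '' closure A, hA.image e.symm.continuous,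
      Filter.mem_of_superset (Metric.closedBall_mem_nhds 0 one_pos) fun φ hφ => ?_⟩
    exact ⟨e (T φ), subset_closure ⟨φ, hφ, rfl⟩, e.symm_apply_apply _⟩
  exact hT.clm_comp (ContinuousMap.toLp (E := ℝ) ∞ surf ℝ)

/-! ### Means and the Fredholm alternative -/

lemma integral_scatteringOp (K : C(S2 × S2, ℝ)) (φ : LInf) :
    ∫ n, scatteringOp K φ n ∂surf = ∫ n', (∫ n, K (n, n') ∂surf) * φ n' ∂surf := by
  rw [integral_congr_ae (scatteringOp_ae K φ), integral_integral_swap]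
  · simp_rw [integral_mul_const]
  · exact ((integrable_coe φ).comp_snd surf).bdd_mul (c := ‖K‖)
      (Continuous.aestronglyMeasurable (by fun_prop))
      (.of_forall fun p => K.norm_coe_le_norm (p.1, p.2))

/-- The scattering kernel with its projection onto the constants removed. -/
def reducedKernel (K : C(S2 × S2, ℝ)) : C(S2 × S2, ℝ) :=
  K - ContinuousMap.const _ (surf.real Set.univ)⁻¹

lemma scatteringOp_reducedKernel (K : C(S2 × S2, ℝ)) {φ : LInf} (h : ∫ n, φ n ∂surf = 0) :
    scatteringOp (reducedKernel K) φ = scatteringOp K φ := by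
  refine Lp.ext ((scatteringOp_ae _ φ).trans (.trans (.of_forall fun n => ?_)
    (scatteringOp_ae K φ).symm))
  simp only [reducedKernel, ContinuousMap.sub_apply, ContinuousMap.const_apply, sub_mul]
  rw [integral_sub (integrable_kernel_mul K φ n) ((integrable_coe φ).const_mul _),
    integral_const_mul, h, mul_zero, sub_zero]

lemma integral_sub_coeFn (φ ψ : LInf) :
    ∫ n, (φ - ψ) n ∂surf = ∫ n, φ n ∂surf - ∫ n, ψ n ∂surf := by
  rw [integral_congr_ae (Lp.coeFn_sub φ ψ)]
  exact integral_sub (integrable_coe φ) (integrable_coe ψ)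

namespace IsScatteringKernel

variable {K : C(S2 × S2, ℝ)}

lemma integral_scatteringOp_eq (hK : IsScatteringKernel K) (φ : LInf) :
    ∫ n, scatteringOp K φ n ∂surf = ∫ n, φ n ∂surf := by
  simp_rw [integral_scatteringOp, hK.integral_eq_one, one_mul]

lemma integral_scatteringOp_reducedKernel (hK : IsScatteringKernel K) (φ : LInf) :
    ∫ n, scatteringOp (reducedKernel K) φ n ∂surf = 0 := by
  have h : ∀ n', ∫ n, reducedKernel K (n, n') ∂surf = 0 := by
    intro n'
    simp only [reducedKernel, ContinuousMap.sub_apply, ContinuousMap.const_apply]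
    rw [integral_sub (integrable_of_continuous (by fun_prop)) (integrable_const _),
      hK.integral_eq_one, integral_const, smul_eq_mul, mul_inv_cancel₀ surf_real_univ_pos.ne', sub_self]
  simp [integral_scatteringOp, h]

lemma ae_eq_const (hK : IsScatteringKernel K) {φ : LInf} (h : scatteringOp K φ = φ) :
    ∃ c : ℝ, φ =ᵐ[surf] fun _ => c := by
  have hφ : φ =ᵐ[surf] scatterFun K φ := by
    have := scatteringOp_ae K φ
    rwa [h] at this
  -- The integral ignores null sets, so the continuous representative satisfies the fixed-point
  -- equation at every point.
  obtain ⟨c, hc⟩ := hK.exists_eq_const (scatterFun K φ).continuous fun n =>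
    integral_congr_ae (hφ.symm.mono fun n' hn' => by simp only [hn'])
  exact ⟨c, hφ.trans (.of_forall hc)⟩

lemma eq_zero_of_reducedKernel_fixed (hK : IsScatteringKernel K) {φ : LInf}
    (h : scatteringOp (reducedKernel K) φ = φ) : φ = 0 := by
  have hint : ∫ n, φ n ∂surf = 0 := by
    rw [← hK.integral_scatteringOp_reducedKernel φ, h]
  obtain ⟨c, hc⟩ := hK.ae_eq_const ((scatteringOp_reducedKernel K hint).symm.trans h)
  rw [integral_congr_ae hc, integral_const, smul_eq_mul] at hint
  have hc0 : c = 0 := (mul_eq_zero.1 hint).resolve_left surf_real_univ_pos.ne'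
  subst hc0
  exact Lp.ext (hc.trans (Lp.coeFn_zero ℝ ∞ surf).symm)

lemma exists_sub_scatteringOp_eq (hK : IsScatteringKernel K) {ψ : LInf}
    (hψ : ∫ n, ψ n ∂surf = 0) : ∃ φ, φ - scatteringOp K φ = ψ := by
  have hunit := ((isCompactOperator_scatteringOp (reducedKernel K)).hasEigenvalue_or_mem_resolventSet
    (one_ne_zero (α := ℝ))).resolve_left fun hev => by
      obtain ⟨φ, hφ⟩ := hev.exists_hasEigenvector
      exact hφ.2 (hK.eq_zero_of_reducedKernel_fixed (by simpa using hφ.apply_eq_smul))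
  rw [spectrum.mem_resolventSet_iff, map_one] at hunit
  obtain ⟨B, hB⟩ := hunit.exists_right_inv
  have hφ : B ψ - scatteringOp (reducedKernel K) (B ψ) = ψ := DFunLike.congr_fun hB ψ
  -- Integrating the equation: `ψ` and the reduced operator's values have mean zero, so the solution
  -- does too, and the reduced operator acts on it as `H`.
  have hint : ∫ n, B ψ n ∂surf = 0 := by
    have := integral_sub_coeFn (B ψ) (scatteringOp (reducedKernel K) (B ψ))
    rwa [hφ, hψ, hK.integral_scatteringOp_reducedKernel, sub_zero, eq_comm] at this
  exact ⟨B ψ, by rw [← scatteringOp_reducedKernel K hint, hφ]⟩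

end IsScatteringKernel
end Scattering
end

theorem proposition2p1 (K : C(Scattering.S2 × Scattering.S2, ℝ))
    (hK : Scattering.IsScatteringKernel K) :
    (∀ φ : Scattering.LInf, Scattering.scatteringOp K φ = φ →
      (∃ f : Scattering.S2 → ℝ, Continuous f ∧ φ =ᵐ[Scattering.surf] f) ∧
      (∃ c : ℝ, φ =ᵐ[Scattering.surf] fun _ => c)) ∧
    Set.range (ContinuousLinearMap.id ℝ Scattering.LInf - Scattering.scatteringOp K) =
      {ψ : Scattering.LInf | ∫ n, ψ n ∂Scattering.surf = 0} := by
  refine ⟨fun φ hφ => ?_, Set.ext fun ψ => ⟨?_, fun hψ => hK.exists_sub_scatteringOp_eq hψ⟩⟩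
  · obtain ⟨c, hc⟩ := hK.ae_eq_const hφ
    exact ⟨⟨fun _ => c, continuous_const, hc⟩, c, hc⟩
  · rintro ⟨φ, rfl⟩
    change ∫ n, (φ - Scattering.scatteringOp K φ) n ∂Scattering.surf = 0
    rw [Scattering.integral_sub_coeFn, hK.integral_scatteringOp_eq, sub_self]
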